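/- Let $G$ be a finite graph, multiple edges and loops allowed, with edges $e_1,\dots,e_m$ and vertices $v_1,\dots,v_n$, and fix an orientation of its edges. Let $d\colon C^0(G,\mathbb Z)=\bigoplus_j\mathbb Z v_j^*\to C^1(G,\mathbb Z)=\bigoplus_i\mathbb Z e_i^*$, $d v_j^*=\sum_{v_j=\operatorname{end}(e_i)}e_i^*-\sum_{v_j=\operatorname{beg}(e_i)}e_i^*$, be the coboundary map, let $H^1(G,\mathbb Z)=\operatorname{coker} d$, and call the class of $e_i^*$ in $H^1(G,\mathbb Z)$ a coedge, again written $e_i^*$. Then $G$ admits a strong $\mathbb Q$-edge-minimizing metric, that is, there is a positive definite quadratic form $q$ on $H^1(G,\mathbb Q)=\mathbb Q\otimes H^1(G,\mathbb Z)$ with values in $\mathbb Q$ such that 1. $q(e_i^*)=1$ for every edge $e_i$ with $e_i^*\neq 0$ in $H^1(G,\mathbb Z)$ (equivalently, for every edge that is not a bridge); 2. $q(v^*)\ge 1$ for every nonzero $v^*\in H^1(G,\mathbb Z)$; 3. if $v^*\in H^1(G,\mathbb Z)$ and $q(v^*)=1$, then $v^*$ or $-v^*$ is a coedge. -/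

import Mathlib

open scoped TensorProduct Graph

/-- An orientation of the edges of a multigraph (loops and multiple edges allowed): for every edge
a choice of a beginning and an end among its two end vertices. -/
structure Graph.Orientation {α β : Type*} (G : Graph α β) where
  /-- the beginning of an edge -/
  beg : E(G) → V(G)
  /-- the end of an edge -/
  fin : E(G) → V(G)
  isLink : ∀ e : E(G), G.IsLink e (beg e) (fin e)

/-- Every multigraph can be oriented. -/
theorem Graph.nonempty_orientation {α β : Type*} (G : Graph α β) : Nonempty G.Orientation := by
  have h : ∀ e : E(G), ∃ p : V(G) × V(G), G.IsLink e p.1 p.2 := by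
    rintro ⟨e, he⟩
    obtain ⟨x, y, hxy⟩ := G.exists_isLink_of_mem_edgeSet he
    exact ⟨(⟨x, hxy.left_mem⟩, ⟨y, hxy.right_mem⟩), hxy⟩
  choose p hp using h
  exact ⟨⟨fun e => (p e).1, fun e => (p e).2, hp⟩⟩

namespace GraphCohomology

section

variable {V E : Type*} (beg fin : E → V)

/-- The coboundary map `d : C⁰(G, ℤ) → C¹(G, ℤ)` of the graph with vertices `V` and edges `E`, where
the edge `e` is oriented from `beg e` to `fin e`. Cochains are integer functions on the vertices,
resp. on the edges, and `(d f)(e) = f (fin e) - f (beg e)`. -/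
def coboundary : (V → ℤ) →ₗ[ℤ] (E → ℤ) where
  toFun f e := f (fin e) - f (beg e)
  map_add' f g := by ext e; simp only [Pi.add_apply]; ring
  map_smul' c f := by ext e; simp only [Pi.smul_apply, smul_eq_mul, RingHom.id_apply]; ring

/-- The first cohomology group `H¹(G, ℤ)`, the cokernel of the coboundary map. -/
abbrev H1 : Type _ := (E → ℤ) ⧸ LinearMap.range (coboundary beg fin)

open scoped Classical in
/-- The coedge `e^*`: the class in `H¹(G, ℤ)` of the cochain that is `1` on the edge `e` and `0` on
all other edges. -/
noncomputable def coedge (e : E) : H1 beg fin :=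
  Submodule.Quotient.mk (Pi.single e (1 : ℤ))

/-- The image of an integral class in `H¹(G, R) = R ⊗ H¹(G, ℤ)`. -/
def toCoeff (R : Type*) [CommRing R] (v : H1 beg fin) : R ⊗[ℤ] H1 beg fin :=
  (1 : R) ⊗ₜ[ℤ] v

variable {beg fin}

/-- An edge-minimizing metric with coefficients in `R`: a positive definite quadratic form on
`H¹(G, R)` with the value `1` on every nonzero coedge and values at least `1` on all nonzero
integral classes. -/
structure IsEMM {R : Type*} [CommRing R] [PartialOrder R]
    (q : QuadraticForm R (R ⊗[ℤ] H1 beg fin)) : Prop where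
  posDef : q.PosDef
  coedge_eq_one : ∀ e : E, coedge beg fin e ≠ 0 → q (toCoeff beg fin R (coedge beg fin e)) = 1
  one_le : ∀ v : H1 beg fin, v ≠ 0 → 1 ≤ q (toCoeff beg fin R v)

/-- A strong edge-minimizing metric: in addition, the value `1` is taken, on integral classes, only
at coedges and their negatives. -/
structure IsStrongEMM {R : Type*} [CommRing R] [PartialOrder R]
    (q : QuadraticForm R (R ⊗[ℤ] H1 beg fin)) : Prop extends IsEMM q where
  eq_coedge_of_eq_one : ∀ v : H1 beg fin, q (toCoeff beg fin R v) = 1 →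
    ∃ e : E, v = coedge beg fin e ∨ -v = coedge beg fin e

end

end GraphCohomology

/-! Call a circulation with values in `{-1, 0, 1}` a unit circulation. The form is `q(v) = 2 ·
E[s(v)²]`, where `s` is a random unit circulation: a uniform circulation modulo `2`, then a uniform
lift of it. Such lifts exist because `s/2` can be rounded to an integral circulation
(`IsCirculation.exists_abs_le_one`).

If `v` is not divisible by `2`, then `s(v)` is odd with probability `1/2`. Since `n² ≥ n mod 2`,
this gives `q(v) ≥ 1`, with equality iff `|s(v)| ≤ 1` for all `s`. Coedges attain equality; classes
divisible by `2` reduce to the others by `q(2w) = 4 q(w)`.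

Conversely, some unit circulation takes on `v` the minimal `ℓ¹`-norm of a representative
(`exists_representative_sum_abs_eq`). So `q(v) = 1` forces this norm to be `1`, and `v` is a coedge
up to sign. Both existence statements are instances of Hoffman's theorem. -/

namespace GraphCohomology

section

variable {V E : Type*} (beg fin : E → V)

/-! ### Hoffman's circulation theorem for integral bounds. -/

section Hoffman

open scoped Classical in
/-- The indicator function of a finite set of vertices. -/
noncomputable def vertexIndicator (R : Finset V) : V → ℤ := fun v => if v ∈ R then 1 else 0

variable [Fintype E]

/-- The integral circulations of a graph: the chains that are orthogonal to all coboundaries. -/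
def IsCirculation (s : E → ℤ) : Prop :=
  ∀ f : V → ℤ, ∑ e, s e * coboundary beg fin f e = 0

/-- The largest value on the coboundary of the indicator of `R` of a chain with values between
`l` and `u`. -/
noncomputable def cutCapacity (l u : E → ℤ) (R : Finset V) : ℤ :=
  ∑ e, max (l e * coboundary beg fin (vertexIndicator R) e)
    (u e * coboundary beg fin (vertexIndicator R) e)

variable {beg fin}

theorem isCirculation_of_forall_vertexIndicator [Finite V] {s : E → ℤ}
    (h : ∀ v : V, ∑ e, s e * coboundary beg fin (vertexIndicator {v}) e = 0) :
    IsCirculation beg fin s := by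
  classical
  cases nonempty_fintype V
  intro f
  have hf : f = ∑ v, f v • vertexIndicator {v} := by
    ext w
    simp [vertexIndicator, Finset.sum_apply]
  rw [hf, map_sum]
  simp only [map_smul, Finset.sum_apply, Pi.smul_apply, smul_eq_mul, Finset.mul_sum]
  rw [Finset.sum_comm]
  refine Finset.sum_eq_zero fun v _ => ?_
  calc _ = f v * ∑ e, s e * coboundary beg fin (vertexIndicator {v}) e := by
        rw [Finset.mul_sum]
        exact Finset.sum_congr rfl fun e _ => by ring
    _ = 0 := by rw [h v, mul_zero]

/-- With equal bounds a vertex and its complement have opposite capacities, so both vanish and the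
net flow at each vertex is zero. -/
theorem isCirculation_of_cutCapacity_self [Finite V] {s : E → ℤ}
    (h : ∀ R : Finset V, 0 ≤ cutCapacity beg fin s s R) : IsCirculation beg fin s := by
  classical
  cases nonempty_fintype V
  refine isCirculation_of_forall_vertexIndicator fun v => ?_
  have h1 := h {v}
  have h2 := h {v}ᶜ
  have h3 : cutCapacity beg fin s s {v}ᶜ = - cutCapacity beg fin s s {v} := by
    simp only [cutCapacity, max_self]
    rw [← Finset.sum_neg_distrib]
    refine Finset.sum_congr rfl fun e _ => ?_
    simp only [coboundary, vertexIndicator, LinearMap.coe_mk, AddHom.coe_mk, Finset.mem_compl]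
    split_ifs <;> simp_all
  have h4 : cutCapacity beg fin s s {v} = 0 := by omega
  simpa [cutCapacity] using h4

/-- Uncrossing of two violated cuts. -/
theorem uncross [DecidableEq E] [DecidableEq V] {l u : E → ℤ} (hlu : ∀ e, l e ≤ u e) {e₀ : E}
    (he₀ : l e₀ < u e₀) (A B : Finset V) :
    cutCapacity beg fin l u (A ∩ B) + cutCapacity beg fin l u (A ∪ B) ≤
      cutCapacity beg fin (Function.update l e₀ (l e₀ + 1)) u A +
        cutCapacity beg fin l (Function.update u e₀ (u e₀ - 1)) B + 1 := by
  -- The inequality holds edge by edge, with the extra `1` charged to `e₀`. Both tightened bounds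
  -- matter only if `e₀` leaves `A` and enters `B`; then it contributes nothing to `A ∩ B` and `A ∪
  -- B`, and `l e₀ < u e₀` suffices.
  have h1 : (1 : ℤ) = ∑ e, if e = e₀ then 1 else 0 := by simp
  rw [h1]
  simp only [cutCapacity, ← Finset.sum_add_distrib]
  refine Finset.sum_le_sum fun e _ => ?_
  have := hlu e
  simp only [coboundary, vertexIndicator, LinearMap.coe_mk, AddHom.coe_mk, Finset.mem_inter,
    Finset.mem_union]
  by_cases he : e = e₀
  · subst he
    simp only [Function.update_self, if_true]
    by_cases h1 : fin e ∈ A <;> by_cases h2 : fin e ∈ B <;> by_cases h3 : beg e ∈ A <;>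
      by_cases h4 : beg e ∈ B <;> simp [h1, h2, h3, h4] <;> omega
  · simp only [Function.update_of_ne he, if_neg he]
    by_cases h1 : fin e ∈ A <;> by_cases h2 : fin e ∈ B <;> by_cases h3 : beg e ∈ A <;>
      by_cases h4 : beg e ∈ B <;> simp [h1, h2, h3, h4]

/-- Hoffman's circulation theorem. -/
theorem exists_isCirculation_of_cutCapacity_nonneg [Finite V] {l u : E → ℤ}
    (hlu : ∀ e, l e ≤ u e) (h : ∀ R : Finset V, 0 ≤ cutCapacity beg fin l u R) :
    ∃ s, IsCirculation beg fin s ∧ ∀ e, l e ≤ s e ∧ s e ≤ u e := by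
  classical
  -- Induction on the total slack: while it is positive, some interval can be shortened by `1` at
  -- one of its ends.
  obtain ⟨n, hn⟩ : ∃ n : ℕ, ∑ e, (u e - l e) = n :=
    ⟨_, (Int.toNat_of_nonneg (Finset.sum_nonneg fun e _ => sub_nonneg.2 (hlu e))).symm⟩
  induction n generalizing l u with
  | zero =>
    have h0 := (Finset.sum_eq_zero_iff_of_nonneg fun e _ => sub_nonneg.2 (hlu e)).1 hn
    obtain rfl : u = l := funext fun e => sub_eq_zero.1 (h0 e (Finset.mem_univ e))
    exact ⟨u, isCirculation_of_cutCapacity_self h, fun e => ⟨le_rfl, le_rfl⟩⟩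
  | succ n ih =>
    obtain ⟨e₀, -, he₀⟩ : ∃ e ∈ Finset.univ, 0 < u e - l e := by
      by_contra! hc
      have := Finset.sum_nonpos hc
      omega
    have he₀ : l e₀ < u e₀ := by omega
    by_cases hA : ∀ R, 0 ≤ cutCapacity beg fin (Function.update l e₀ (l e₀ + 1)) u R
    · obtain ⟨s, hs, hb⟩ := ih (l := Function.update l e₀ (l e₀ + 1)) (u := u)
        (fun e => by
          by_cases he : e = e₀
          · subst he; simpa using he₀
          · simpa [he] using hlu e) hA (by
          have : ∀ e, u e - Function.update l e₀ (l e₀ + 1) e =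
              (u e - l e) - if e = e₀ then 1 else 0 := fun e => by
            by_cases he : e = e₀
            · subst he; simp; ring
            · simp [he]
          simp only [this, Finset.sum_sub_distrib (f := fun e => u e - l e), hn]
          simp)
      refine ⟨s, hs, fun e => ⟨?_, (hb e).2⟩⟩
      have := (hb e).1
      by_cases he : e = e₀
      · subst he; simp at this; omega
      · simpa [he] using this
    by_cases hB : ∀ R, 0 ≤ cutCapacity beg fin l (Function.update u e₀ (u e₀ - 1)) R
    · obtain ⟨s, hs, hb⟩ := ih (l := l) (u := Function.update u e₀ (u e₀ - 1))
        (fun e => by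
          by_cases he : e = e₀
          · subst he; simp; omega
          · simpa [he] using hlu e) hB (by
          have : ∀ e, Function.update u e₀ (u e₀ - 1) e - l e =
              (u e - l e) - if e = e₀ then 1 else 0 := fun e => by
            by_cases he : e = e₀
            · subst he; simp; ring
            · simp [he]
          simp only [this, Finset.sum_sub_distrib (f := fun e => u e - l e), hn]
          simp)
      refine ⟨s, hs, fun e => ⟨(hb e).1, ?_⟩⟩
      have := (hb e).2
      by_cases he : e = e₀
      · subst he; simp at this; omega
      · simpa [he] using this
    push Not at hA hB
    obtain ⟨A, hA⟩ := hA
    obtain ⟨B, hB⟩ := hB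
    -- Both violated capacities are at most `-1`, so uncrossing would make a sum of two nonnegative
    -- capacities negative.
    have h1 := uncross (beg := beg) (fin := fin) hlu he₀ A B
    have h2 := h (A ∩ B)
    have h3 := h (A ∪ B)
    omega

end Hoffman

/-! ### Unit circulations from Hoffman's theorem. -/

section Circulations

variable [Fintype E] [Finite V] {beg fin}

/-- Every circulation is congruent modulo `2` to one with values in `{-1, 0, 1}`. -/
theorem IsCirculation.exists_abs_le_one {s : E → ℤ} (hs : IsCirculation beg fin s) :
    ∃ t, IsCirculation beg fin t ∧ (∀ e, |t e| ≤ 1) ∧ ∀ e, (t e : ZMod 2) = s e := by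
  -- The bounds are the floor and ceiling of `s / 2`, which itself satisfies them, whence the cut
  -- condition. Then `s - 2 * r` is the required circulation.
  obtain ⟨r, hr, hb⟩ := exists_isCirculation_of_cutCapacity_nonneg (beg := beg) (fin := fin)
    (l := fun e => s e / 2) (u := fun e => (s e + 1) / 2) (fun e => by omega) (fun R => by
      have h := hs (vertexIndicator R)
      have : ∑ e, s e * coboundary beg fin (vertexIndicator R) e ≤
          2 * cutCapacity beg fin (fun e => s e / 2) (fun e => (s e + 1) / 2) R := by
        rw [cutCapacity, Finset.mul_sum]
        refine Finset.sum_le_sum fun e _ => ?_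
        simp only [coboundary, vertexIndicator, LinearMap.coe_mk, AddHom.coe_mk]
        split_ifs <;> simp <;> omega
      omega)
  refine ⟨fun e => s e - 2 * r e, fun f => ?_, fun e => ?_, fun e => ?_⟩
  · have h1 := hs f
    have h2 := hr f
    simp only [sub_mul, mul_assoc, Finset.sum_sub_distrib, ← Finset.mul_sum, h1, h2]
    simp
  · have := hb e
    change |s e - 2 * r e| ≤ 1
    rw [abs_le]
    omega
  · have : (2 : ZMod 2) = 0 := rfl
    push_cast
    simp [this]

/-- Every class in `H¹(G, ℤ)` has a representative whose `ℓ¹`-norm is the value on it of a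
circulation with values in `{-1, 0, 1}`. -/
theorem exists_representative_sum_abs_eq (v : H1 beg fin) :
    ∃ y : E → ℤ, Submodule.Quotient.mk y = v ∧
      ∃ s, IsCirculation beg fin s ∧ (∀ e, |s e| ≤ 1) ∧ ∑ e, s e * y e = ∑ e, |y e| := by
  obtain ⟨y, hy, hmin⟩ : ∃ y : E → ℤ, (Submodule.Quotient.mk y : H1 beg fin) = v ∧
      ∀ z : E → ℤ, (Submodule.Quotient.mk z : H1 beg fin) = v → ∑ e, |y e| ≤ ∑ e, |z e| := by
    obtain ⟨y₀, hy₀⟩ := Submodule.Quotient.mk_surjective _ v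
    obtain ⟨y, hy, hm⟩ := (measure fun y : E → ℤ => ∑ e, (y e).natAbs).wf.has_min
      {y | (Submodule.Quotient.mk y : H1 beg fin) = v} ⟨y₀, hy₀⟩
    refine ⟨y, hy, fun z hz => ?_⟩
    have : ∑ e, (y e).natAbs ≤ ∑ e, (z e).natAbs := not_lt.1 (hm z hz)
    simp only [Int.abs_eq_natAbs]
    exact_mod_cast this
  refine ⟨y, hy, ?_⟩
  -- The bounds force `s e` to be the sign of `y e` where `y e ≠ 0`. The capacity of `R` is the
  -- change of the `ℓ¹`-norm when the coboundary of its indicator is added to `y`, hence nonnegative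
  -- by minimality.
  obtain ⟨s, hs, hb⟩ := exists_isCirculation_of_cutCapacity_nonneg (beg := beg) (fin := fin)
    (l := fun e => if 0 < y e then 1 else -1) (u := fun e => if y e < 0 then -1 else 1)
    (fun e => by split_ifs <;> omega) (fun R => by
      have h := hmin (y + coboundary beg fin (vertexIndicator R)) (by
        rw [← hy, Submodule.Quotient.eq]
        simp)
      have : cutCapacity beg fin (fun e => if 0 < y e then 1 else -1)
          (fun e => if y e < 0 then -1 else 1) R =
          ∑ e, |(y + coboundary beg fin (vertexIndicator R)) e| - ∑ e, |y e| := by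
        rw [cutCapacity, ← Finset.sum_sub_distrib]
        refine Finset.sum_congr rfl fun e _ => ?_
        simp only [coboundary, vertexIndicator, LinearMap.coe_mk, AddHom.coe_mk, Pi.add_apply]
        rcases lt_trichotomy (y e) 0 with h | h | h <;> split_ifs <;> simp [abs] <;> omega
      omega)
  refine ⟨s, hs, fun e => ?_, Finset.sum_congr rfl fun e _ => ?_⟩
  · have := hb e
    rw [abs_le]
    split_ifs at this <;> omega
  · have := hb e
    rcases lt_trichotomy (y e) 0 with h | h | h
    · rw [if_neg (by omega), if_pos h] at this
      rw [abs_of_neg h, show s e = -1 by omega]; ring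
    · simp [h]
    · rw [if_pos h, if_neg (by omega)] at this
      rw [abs_of_pos h, show s e = 1 by omega]; ring

end Circulations

end

section

variable {V E : Type*} {beg fin : E → V} [Fintype E]

/-- A common denominator reduces positive definiteness over `ℚ` to integral classes. -/
theorem exists_eq_tmul {M : Type*} [AddCommGroup M] (x : ℚ ⊗[ℤ] M) : ∃ (r : ℚ) (v : M),
    x = r ⊗ₜ v := by
  induction x using TensorProduct.induction_on with
  | zero => exact ⟨0, 0, by simp⟩
  | tmul r v => exact ⟨r, v, rfl⟩
  | add x y hx hy =>
    obtain ⟨r, v, rfl⟩ := hx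
    obtain ⟨r', v', rfl⟩ := hy
    have h1 : (r.den : ℚ) ≠ 0 := by exact_mod_cast r.den_ne_zero
    have h2 : (r'.den : ℚ) ≠ 0 := by exact_mod_cast r'.den_ne_zero
    refine ⟨1 / (r.den * r'.den), (r.num * r'.den) • v + (r'.num * r.den) • v', ?_⟩
    rw [TensorProduct.tmul_add, ← TensorProduct.smul_tmul, ← TensorProduct.smul_tmul]
    congr 2
    · conv_lhs => rw [← Rat.num_div_den r]
      rw [zsmul_eq_mul]
      push_cast
      field_simp
    · conv_lhs => rw [← Rat.num_div_den r']
      rw [zsmul_eq_mul]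
      push_cast
      field_simp

/-! ### Duality between circulations and cohomology classes. -/

section Pairing

/-- The pairing of a circulation with the classes in `H¹(G, ℤ)`. -/
def IsCirculation.pairing {s : E → ℤ} (hs : IsCirculation beg fin s) : H1 beg fin →ₗ[ℤ] ℤ :=
  Submodule.liftQ _ (Fintype.linearCombination ℤ s) (by
    rintro _ ⟨f, rfl⟩
    simpa [Fintype.linearCombination_apply, mul_comm] using hs f)

theorem IsCirculation.pairing_mk {s : E → ℤ} (hs : IsCirculation beg fin s) (y : E → ℤ) :
    hs.pairing (Submodule.Quotient.mk y) = ∑ e, s e * y e := by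
  simp [IsCirculation.pairing, Fintype.linearCombination_apply, mul_comm]

theorem IsCirculation.pairing_coedge {s : E → ℤ} (hs : IsCirculation beg fin s) (e : E) :
    hs.pairing (coedge beg fin e) = s e := by
  classical
  simp [coedge, hs.pairing_mk, Pi.single_apply]

/-- The functional on cochains of degree `0` given by the boundary of a chain. -/
def boundaryFunctional (beg fin : E → V) : (E → ℤ) →ₗ[ℤ] Module.Dual ℤ (V → ℤ) :=
  (LinearMap.llcomp ℤ (V → ℤ) (E → ℤ) ℤ).flip (coboundary beg fin) ∘ₗ dotProductBilin ℤ ℤ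

theorem boundaryFunctional_apply (s : E → ℤ) (f : V → ℤ) :
    boundaryFunctional beg fin s f = ∑ e, s e * coboundary beg fin f e := rfl

theorem boundaryFunctional_eq_zero_iff {s : E → ℤ} :
    boundaryFunctional beg fin s = 0 ↔ IsCirculation beg fin s := by
  simp [LinearMap.ext_iff, boundaryFunctional_apply, IsCirculation]

/-- The circulations are the image of a projection of the lattice of chains. -/
theorem exists_projection_circulations (beg fin : E → V) :
    ∃ p : (E → ℤ) →ₗ[ℤ] (E → ℤ), (∀ x, IsCirculation beg fin (p x)) ∧
      ∀ s, IsCirculation beg fin s → p s = s := by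
  -- The range is finitely generated and torsion-free over `ℤ`, hence projective, so the boundary
  -- map splits onto it.
  obtain ⟨g, hg⟩ := Module.projective_lifting_property (boundaryFunctional beg fin).rangeRestrict
    LinearMap.id (LinearMap.surjective_rangeRestrict _)
  refine ⟨LinearMap.id - g ∘ₗ (boundaryFunctional beg fin).rangeRestrict, fun x => ?_,
    fun s hs => ?_⟩
  · have := congrArg Subtype.val
      (LinearMap.congr_fun hg ((boundaryFunctional beg fin).rangeRestrict x))
    simp only [LinearMap.coe_comp, Function.comp_apply, LinearMap.id_coe, id_eq,
      LinearMap.codRestrict_apply, LinearMap.rangeRestrict] at this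
    rw [← boundaryFunctional_eq_zero_iff, LinearMap.sub_apply, map_sub]
    exact sub_eq_zero.2 this.symm
  · have : (boundaryFunctional beg fin).rangeRestrict s = 0 :=
      Subtype.ext (boundaryFunctional_eq_zero_iff.2 hs)
    simp [this]

variable [Finite V]

/-- On a norm-minimal representative some unit circulation takes its `ℓ¹`-norm as value, which
vanishes only for the zero cochain. -/
theorem exists_pairing_ne_zero {v : H1 beg fin} (hv : v ≠ 0) :
    ∃ s, ∃ hs : IsCirculation beg fin s, (∀ e, |s e| ≤ 1) ∧ hs.pairing v ≠ 0 := by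
  obtain ⟨y, rfl, s, hs, hb, h⟩ := exists_representative_sum_abs_eq v
  refine ⟨s, hs, hb, fun h0 => hv ?_⟩
  rw [hs.pairing_mk, h, Finset.sum_eq_zero_iff_of_nonneg fun e _ => abs_nonneg _] at h0
  have : y = 0 := funext fun e => abs_eq_zero.1 (h0 e (Finset.mem_univ e))
  rw [this, Submodule.Quotient.mk_zero]

/-- A class with even values on all circulations is divisible by `2`. -/
theorem exists_eq_two_smul {v : H1 beg fin}
    (h : ∀ s, ∀ hs : IsCirculation beg fin s, Even (hs.pairing v)) :
    ∃ w : H1 beg fin, v = (2 : ℤ) • w := by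
  classical
  obtain ⟨p, hp, hps⟩ := exists_projection_circulations beg fin
  obtain ⟨y, rfl⟩ := Submodule.Quotient.mk_surjective _ v
  -- `z e` is half the value on `v` of the projected edge `e`. These projections span the
  -- circulations, so every circulation vanishes on `v - 2z`.
  choose z hz using fun e => (h _ (hp (Pi.single e 1))).two_dvd
  refine ⟨Submodule.Quotient.mk z, sub_eq_zero.1 (by_contra fun hne => ?_)⟩
  obtain ⟨s, hs, -, hne⟩ := exists_pairing_ne_zero hne
  refine hne ?_
  have hs' : s = ∑ e, s e • p (Pi.single e 1) := by
    conv_lhs => rw [← hps s hs, pi_eq_sum_univ' s, map_sum]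
    refine Finset.sum_congr rfl fun e _ => ?_
    rw [map_smul]
  rw [map_sub, map_smul, hs.pairing_mk, hs.pairing_mk, sub_eq_zero, smul_eq_mul, Finset.mul_sum]
  calc ∑ e, s e * y e = ∑ e', s e' * ∑ e, p (Pi.single e' 1) e * y e := by
        conv_lhs => rw [hs']
        simp only [Finset.sum_apply, Pi.smul_apply, smul_eq_mul, Finset.sum_mul, Finset.mul_sum]
        rw [Finset.sum_comm]
        simp only [mul_assoc]
    _ = _ := Finset.sum_congr rfl fun e _ => by
        rw [← (hp _).pairing_mk, hz]
        ring

end Pairing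

/-! ### The random unit circulation and its mean square form. -/

section Form

variable (beg fin)

/-- The circulations with values in `{-1, 0, 1}`. -/
def UnitCirculation : Type _ := {s : E → ℤ // IsCirculation beg fin s ∧ ∀ e, |s e| ≤ 1}

instance : Finite (UnitCirculation beg fin) := by
  classical
  refine Set.Finite.to_subtype ((Fintype.piFinset fun _ : E => Finset.Icc (-1 : ℤ) 1).finite_toSet
    |>.subset fun s hs => ?_)
  simp only [Finset.mem_coe, Fintype.mem_piFinset, Finset.mem_Icc]
  exact fun e => abs_le.1 (hs.2 e)

noncomputable instance : Fintype (UnitCirculation beg fin) := Fintype.ofFinite _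

/-- The circulations modulo `2`. -/
def circulationsModTwo : AddSubgroup (E → ZMod 2) where
  carrier := {w | ∃ s : E → ℤ, IsCirculation beg fin s ∧ ∀ e, (s e : ZMod 2) = w e}
  zero_mem' := ⟨0, fun f => by simp, fun e => by simp⟩
  add_mem' := by
    rintro _ _ ⟨s, hs, h⟩ ⟨t, ht, h'⟩
    exact ⟨s + t, fun f => by simp [add_mul, Finset.sum_add_distrib, hs f, ht f],
      fun e => by simp [h, h']⟩
  neg_mem' := by
    rintro _ ⟨s, hs, h⟩
    exact ⟨-s, fun f => by simp [hs f], fun e => by simp [h]⟩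

noncomputable instance : Fintype (circulationsModTwo beg fin) := Fintype.ofFinite _

variable {beg fin}

/-- The reduction of a circulation modulo `2`. -/
def UnitCirculation.modTwo (s : UnitCirculation beg fin) : circulationsModTwo beg fin :=
  ⟨fun e => s.1 e, s.1, s.2.1, fun _ => rfl⟩

theorem UnitCirculation.modTwo_surjective [Finite V] :
    Function.Surjective (modTwo : UnitCirculation beg fin → circulationsModTwo beg fin) := by
  rintro ⟨w, s, hs, hw⟩
  obtain ⟨t, ht, hb, h⟩ := hs.exists_abs_le_one
  exact ⟨⟨t, ht, hb⟩, Subtype.ext (funext fun e => (h e).trans (hw e))⟩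

open scoped Classical in
/-- The number of unit circulations with a given reduction modulo `2`. -/
noncomputable def liftCount (w : circulationsModTwo beg fin) : ℕ :=
  (Finset.univ.filter fun s : UnitCirculation beg fin => s.modTwo = w).card

/-- Twice the probability of a unit circulation that is a uniformly chosen lift of a uniformly
chosen circulation modulo `2`. -/
noncomputable def UnitCirculation.weight (s : UnitCirculation beg fin) : ℚ :=
  2 / Fintype.card (circulationsModTwo beg fin) / liftCount s.modTwo

theorem UnitCirculation.weight_pos (s : UnitCirculation beg fin) : 0 < s.weight := by
  classical
  have h1 : 0 < liftCount s.modTwo := Finset.card_pos.2 ⟨s, by simp⟩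
  have h2 : 0 < Fintype.card (circulationsModTwo beg fin) := Fintype.card_pos
  unfold weight
  positivity

/-- Every fibre of `modTwo` is nonempty and its weights add up to the same constant, so the
reduction is uniformly distributed. -/
theorem sum_weight_mul_modTwo [Finite V] (g : circulationsModTwo beg fin → ℚ) :
    ∑ s : UnitCirculation beg fin, s.weight * g s.modTwo =
      2 / Fintype.card (circulationsModTwo beg fin) * ∑ w, g w := by
  classical
  rw [← Finset.sum_fiberwise (g := UnitCirculation.modTwo), Finset.mul_sum]
  refine Finset.sum_congr rfl fun w _ => ?_
  have h : liftCount w ≠ 0 := by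
    obtain ⟨s, rfl⟩ := UnitCirculation.modTwo_surjective w
    exact (Finset.card_pos.2 ⟨s, by simp⟩).ne'
  calc _ = ∑ s : UnitCirculation beg fin with s.modTwo = w,
        2 / (Fintype.card (circulationsModTwo beg fin) : ℚ) / liftCount w * g w :=
      Finset.sum_congr rfl fun s hs => by
        rw [UnitCirculation.weight, (Finset.mem_filter.1 hs).2]
    _ = _ := by
      rw [Finset.sum_const, nsmul_eq_mul]
      change (liftCount w : ℚ) * _ = _
      field_simp

/-- A nonzero homomorphism to `ZMod 2` is nonzero on half of the elements. -/
theorem two_mul_sum_ite_eq_card {A : Type*} [AddCommGroup A] [Fintype A] (φ : A →+ ZMod 2)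
    {a : A} (ha : φ a ≠ 0) :
    2 * ∑ x, (if φ x = 0 then 0 else 1 : ℚ) = Fintype.card A := by
  -- Translation by `a` exchanges the zeros and the nonzeros of `φ`.
  have h1 := Equiv.sum_comp (Equiv.addRight a) fun x => (if φ x = 0 then 0 else 1 : ℚ)
  rw [two_mul]
  nth_rewrite 1 [← h1]
  rw [← Finset.sum_add_distrib, Fintype.card_eq_sum_ones, Nat.cast_sum]
  refine Finset.sum_congr rfl fun x _ => ?_
  have key : ∀ b c : ZMod 2, b ≠ 0 → ((c + b = 0 ↔ ¬ c = 0)) := by decide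
  simp only [Equiv.coe_addRight, map_add, key _ (φ x) ha]
  by_cases h : φ x = 0 <;> simp [h]

theorem intCast_emod_two_eq_ite (n : ℤ) :
    ((n % 2 : ℤ) : ℚ) = if (n : ZMod 2) = 0 then 0 else 1 := by
  have := ZMod.intCast_zmod_eq_zero_iff_dvd n 2
  split_ifs with h
  · have := this.1 h
    have h2 : n % 2 = 0 := by omega
    simp [h2]
  · rw [this] at h
    have h2 : n % 2 = 1 := by omega
    simp [h2]

/-- The expected parity of the pairing with a class that is not divisible by `2`. -/
theorem sum_weight_mul_emod_two [Finite V] {v : H1 beg fin} {t : E → ℤ}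
    {ht : IsCirculation beg fin t} (h : ¬ Even (ht.pairing v)) :
    ∑ s : UnitCirculation beg fin, s.weight * ((s.2.1.pairing v % 2 : ℤ) : ℚ) = 1 := by
  obtain ⟨y, rfl⟩ := Submodule.Quotient.mk_surjective _ v
  -- The parity of the pairing depends only on `s` modulo `2`; the odd value at `t` makes this
  -- homomorphism nonzero.
  let φ : circulationsModTwo beg fin →+ ZMod 2 :=
    { toFun := fun w => ∑ e, w.1 e * (y e : ZMod 2)
      map_zero' := by simp
      map_add' := fun a b => by simp [add_mul, Finset.sum_add_distrib] }
  have hφ : φ ⟨fun e => t e, t, ht, fun _ => rfl⟩ ≠ 0 := by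
    intro h0
    refine h ?_
    rw [even_iff_two_dvd]
    refine (ZMod.intCast_zmod_eq_zero_iff_dvd _ 2).1 ?_
    rw [ht.pairing_mk]
    push_cast
    exact h0
  have h1 := two_mul_sum_ite_eq_card φ hφ
  have h2 := sum_weight_mul_modTwo fun w => (if φ w = 0 then 0 else 1 : ℚ)
  have h3 : (Fintype.card (circulationsModTwo beg fin) : ℚ) ≠ 0 := by
    exact_mod_cast Fintype.card_ne_zero
  rw [div_mul_eq_mul_div, h1, div_self h3] at h2
  rw [← h2]
  refine Finset.sum_congr rfl fun s _ => ?_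
  rw [intCast_emod_two_eq_ite, s.2.1.pairing_mk]
  push_cast
  rfl

/-- The pairing of a unit circulation with the classes in `H¹(G, ℚ)`. -/
noncomputable def UnitCirculation.functional (s : UnitCirculation beg fin) :
    ℚ ⊗[ℤ] H1 beg fin →ₗ[ℚ] ℚ :=
  LinearMap.liftBaseChange ℚ (Algebra.linearMap ℤ ℚ ∘ₗ s.2.1.pairing)

theorem UnitCirculation.functional_tmul (s : UnitCirculation beg fin) (r : ℚ) (v : H1 beg fin) :
    s.functional (r ⊗ₜ v) = r * s.2.1.pairing v := by
  simp [functional]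

variable (beg fin)

/-- Twice the mean square of the pairing with a random unit circulation. -/
noncomputable def meanSquareForm : QuadraticForm ℚ (ℚ ⊗[ℤ] H1 beg fin) :=
  ∑ s : UnitCirculation beg fin, s.weight • QuadraticMap.sq.comp s.functional

variable {beg fin}

theorem meanSquareForm_tmul (r : ℚ) (v : H1 beg fin) :
    meanSquareForm beg fin (r ⊗ₜ v) =
      r ^ 2 * ∑ s : UnitCirculation beg fin, s.weight * (s.2.1.pairing v : ℚ) ^ 2 := by
  rw [meanSquareForm, sum_apply, Finset.mul_sum]
  refine Finset.sum_congr rfl fun s _ => ?_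
  simp only [smul_apply, QuadraticMap.comp_apply, QuadraticMap.sq_apply,
    s.functional_tmul, smul_eq_mul]
  ring

theorem meanSquareForm_toCoeff (v : H1 beg fin) :
    meanSquareForm beg fin (toCoeff beg fin ℚ v) =
      ∑ s : UnitCirculation beg fin, s.weight * (s.2.1.pairing v : ℚ) ^ 2 := by
  rw [toCoeff, meanSquareForm_tmul, one_pow, one_mul]

theorem meanSquareForm_two_smul (w : H1 beg fin) :
    meanSquareForm beg fin (toCoeff beg fin ℚ ((2 : ℤ) • w)) =
      4 * meanSquareForm beg fin (toCoeff beg fin ℚ w) := by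
  simp only [meanSquareForm_toCoeff, Finset.mul_sum, map_smul]
  refine Finset.sum_congr rfl fun s _ => ?_
  push_cast [smul_eq_mul]
  ring

theorem cast_emod_two_le_sq (n : ℤ) : ((n % 2 : ℤ) : ℚ) ≤ (n : ℚ) ^ 2 := by
  have : n % 2 ≤ n ^ 2 := by
    rcases eq_or_ne n 0 with rfl | h
    · simp
    · have : 0 < n ^ 2 := by positivity
      omega
  exact_mod_cast this

/-! ### Lower bound, equality case and positive definiteness. -/

variable [Finite V]

theorem one_le_meanSquareForm_of_not_even {v : H1 beg fin} {t : E → ℤ}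
    {ht : IsCirculation beg fin t} (h : ¬ Even (ht.pairing v)) :
    1 ≤ meanSquareForm beg fin (toCoeff beg fin ℚ v) := by
  rw [meanSquareForm_toCoeff, ← sum_weight_mul_emod_two h]
  exact Finset.sum_le_sum fun s _ =>
    mul_le_mul_of_nonneg_left (cast_emod_two_le_sq _) s.weight_pos.le

/-- As all weights are positive, equality of the sums forces `n % 2 = n ^ 2` for each pairing `n`.
-/
theorem abs_pairing_le_one {v : H1 beg fin} {t : E → ℤ} {ht : IsCirculation beg fin t}
    (h : ¬ Even (ht.pairing v)) (h1 : meanSquareForm beg fin (toCoeff beg fin ℚ v) = 1)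
    (s : UnitCirculation beg fin) : |s.2.1.pairing v| ≤ 1 := by
  rw [meanSquareForm_toCoeff, ← sum_weight_mul_emod_two h, eq_comm,
    Finset.sum_eq_sum_iff_of_le fun s _ =>
      mul_le_mul_of_nonneg_left (cast_emod_two_le_sq _) s.weight_pos.le] at h1
  have h2 := mul_left_cancel₀ s.weight_pos.ne' (h1 s (Finset.mem_univ s))
  have h3 : s.2.1.pairing v % 2 = s.2.1.pairing v ^ 2 := by exact_mod_cast h2
  rw [← sq_le_one_iff_abs_le_one]
  omega

/-- A unit circulation takes a value in `{-1, 0, 1}` on `e`, where the square equals the parity. -/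
theorem meanSquareForm_coedge {e : E} (he : coedge beg fin e ≠ 0) :
    meanSquareForm beg fin (toCoeff beg fin ℚ (coedge beg fin e)) = 1 := by
  have key : ∀ {n : ℤ}, |n| ≤ 1 → n = -1 ∨ n = 0 ∨ n = 1 := fun h => by
    rw [abs_le] at h; omega
  obtain ⟨t, ht, hb, h0⟩ := exists_pairing_ne_zero he
  have h : ¬ Even (ht.pairing (coedge beg fin e)) := by
    rw [ht.pairing_coedge] at h0 ⊢
    rcases key (hb e) with h | h | h <;> simp_all
  rw [meanSquareForm_toCoeff, ← sum_weight_mul_emod_two h]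
  refine Finset.sum_congr rfl fun s _ => ?_
  rw [s.2.1.pairing_coedge]
  rcases key (s.2.2 e) with h | h | h <;> simp [h]

theorem sum_weight_mul_sq_pos {v : H1 beg fin} (hv : v ≠ 0) :
    0 < ∑ s : UnitCirculation beg fin, s.weight * (s.2.1.pairing v : ℚ) ^ 2 := by
  obtain ⟨t, ht, hb, h0⟩ := exists_pairing_ne_zero hv
  refine Finset.sum_pos' (fun s _ => mul_nonneg s.weight_pos.le (sq_nonneg _))
    ⟨⟨t, ht, hb⟩, Finset.mem_univ _, mul_pos (UnitCirculation.weight_pos _) ?_⟩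
  have : (ht.pairing v : ℚ) ≠ 0 := by exact_mod_cast h0
  positivity

theorem one_le_meanSquareForm {v : H1 beg fin} (hv : v ≠ 0) :
    1 ≤ meanSquareForm beg fin (toCoeff beg fin ℚ v) := by
  obtain ⟨t, ht, hb, h0⟩ := exists_pairing_ne_zero hv
  -- Descent on the value at the fixed `t`: halving an everywhere even class halves this nonzero
  -- integer.
  obtain ⟨n, hn⟩ : ∃ n, n = (ht.pairing v).natAbs := ⟨_, rfl⟩
  induction n using Nat.strong_induction_on generalizing v with
  | _ n ih =>
    by_cases h : ∀ s, ∀ hs : IsCirculation beg fin s, Even (hs.pairing v)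
    · obtain ⟨w, rfl⟩ := exists_eq_two_smul h
      have hw : w ≠ 0 := by rintro rfl; simp at hv
      rw [map_smul, smul_eq_mul] at h0 hn
      have := ih (ht.pairing w).natAbs (by omega) hw (by omega) rfl
      rw [meanSquareForm_toCoeff] at this ⊢
      refine this.trans (Finset.sum_le_sum fun s _ =>
        mul_le_mul_of_nonneg_left ?_ s.weight_pos.le)
      rw [map_smul]
      push_cast [smul_eq_mul]
      nlinarith [sq_nonneg (s.2.1.pairing w : ℚ)]
    · push Not at h
      obtain ⟨s, hs, h⟩ := h
      exact one_le_meanSquareForm_of_not_even (ht := hs) (by simpa using h)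

theorem eq_coedge_or_neg_eq_coedge {v : H1 beg fin}
    (h1 : meanSquareForm beg fin (toCoeff beg fin ℚ v) = 1) :
    ∃ e : E, v = coedge beg fin e ∨ -v = coedge beg fin e := by
  classical
  have hv : v ≠ 0 := by
    rintro rfl
    simp [meanSquareForm_toCoeff] at h1
  obtain ⟨t, ht, h⟩ : ∃ t, ∃ ht : IsCirculation beg fin t, ¬ Even (ht.pairing v) := by
    -- A class divisible by `2` would have value at least `4`.
    by_contra! hc
    obtain ⟨w, rfl⟩ := exists_eq_two_smul fun s hs => by simpa using hc s hs
    have hw : w ≠ 0 := by rintro rfl; simp at hv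
    rw [meanSquareForm_two_smul] at h1
    linarith [one_le_meanSquareForm hw]
  obtain ⟨y, rfl, s, hs, hb, hy⟩ := exists_representative_sum_abs_eq v
  -- The circulation attaining the norm of `y` bounds that norm by `1`, so `y` is supported on a
  -- single edge.
  have h2 := abs_pairing_le_one h h1 ⟨s, hs, hb⟩
  rw [hs.pairing_mk, hy] at h2
  have h3 := (le_abs_self _).trans h2
  obtain ⟨e, he⟩ : ∃ e, y e ≠ 0 := by
    by_contra! hc
    exact hv (by rw [show y = 0 from funext hc, Submodule.Quotient.mk_zero])
  have h4 : |y e| + ∑ e' ∈ Finset.univ.erase e, |y e'| ≤ 1 := by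
    rwa [Finset.add_sum_erase _ (fun e => |y e|) (Finset.mem_univ e)]
  have h5 : 0 < |y e| := abs_pos.2 he
  have h6 : 0 ≤ ∑ e' ∈ Finset.univ.erase e, |y e'| := Finset.sum_nonneg fun _ _ => abs_nonneg _
  have h7 : ∑ e' ∈ Finset.univ.erase e, |y e'| = 0 := by omega
  rw [Finset.sum_eq_zero_iff_of_nonneg fun _ _ => abs_nonneg _] at h7
  have h8 : y = Pi.single e (y e) := by
    ext e'
    by_cases hee : e' = e
    · subst hee; simp
    · simpa [hee] using h7 e' (by simp [hee])
  refine ⟨e, ?_⟩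
  rcases eq_or_eq_neg_of_abs_eq (show |y e| = 1 by omega) with h9 | h9
  · left
    rw [h8, h9, coedge]
  · right
    rw [h8, h9, coedge, ← Submodule.Quotient.mk_neg, ← Pi.single_neg, neg_neg]

theorem meanSquareForm_posDef : (meanSquareForm beg fin).PosDef := by
  intro x hx
  obtain ⟨r, v, rfl⟩ := exists_eq_tmul x
  have hr : r ≠ 0 := by rintro rfl; simp at hx
  have hv : v ≠ 0 := by rintro rfl; simp at hx
  rw [meanSquareForm_tmul]
  exact mul_pos (by positivity) (sum_weight_mul_sq_pos hv)

theorem meanSquareForm_isStrongEMM : IsStrongEMM (meanSquareForm beg fin) where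
  posDef := meanSquareForm_posDef
  coedge_eq_one _ he := meanSquareForm_coedge he
  one_le _ hv := one_le_meanSquareForm hv
  eq_coedge_of_eq_one _ h := eq_coedge_or_neg_eq_coedge h

end Form

end

end GraphCohomology

theorem theorem5 {α β : Type*} (G : Graph α β) [Finite V(G)] [Finite E(G)] (o : G.Orientation) :
    ∃ q : QuadraticForm ℚ (ℚ ⊗[ℤ] GraphCohomology.H1 o.beg o.fin),
      GraphCohomology.IsStrongEMM q := by
  cases nonempty_fintype E(G)
  exact ⟨GraphCohomology.meanSquareForm o.beg o.fin, GraphCohomology.meanSquareForm_isStrongEMM⟩
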